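/- Let $r \ge 2$, let $F_r$ be the free group on $a_1,\dots,a_r$ with word length $|\cdot|$, and let $\mathbf{B}$ be the set of right-infinite reduced words in the letters $a_1^{\pm1},\dots,a_r^{\pm1}$, with the topology generated by the sets $\mathbf{B}_u$ of infinite words with prefix $u$ ($u \in F_r\setminus\{e\}$). The group $F_r$ acts on $\mathbf{B}$ by left multiplication (followed by reduction). Let $\mu_{x_0}$ be the Borel probability measure on $\mathbf{B}$ with $\mu_{x_0}(\mathbf{B}_u) = \frac{1}{2r(2r-1)^{|u|-1}}$ for all $u \ne e$. For $\gamma \in F_r$ and $\xi = u_1u_2u_3\cdots \in \mathbf{B}$ put $P(\gamma,\xi) = (2r-1)^{\beta_\xi(e,\gamma)}$, where $\beta_\xi(e,\gamma) = \lim_{n\to\infty} \left(|u_1\cdots u_n| - |\gamma^{-1}u_1\cdots u_n|\right)$. Let $\pi$ be the quasi-regular representation, i.e. the unitary representation of $F_r$ on $L^2(\mathbf{B},\mu_{x_0})$ (complex-valued functions) given by $$(\pi(\gamma)g)(\xi) = P(\gamma,\xi)^{1/2}\, g(\gamma^{-1}\xi).$$ Then $\pi$ is irreducible: $L^2(\mathbf{B},\mu_{x_0})$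 is nonzero, and its only closed $\pi(F_r)$-invariant subspaces are $\{0\}$ and $L^2(\mathbf{B},\mu_{x_0})$. Moreover, the orthogonal projection onto the subspace of constant functions lies in the von Neumann algebra $\pi(F_r)''$ generated by $\pi$, and the constant function $\mathbf{1}_{\mathbf{B}}$ is a cyclic vector of $\pi$ (the linear span of $\{\pi(\gamma)\mathbf{1}_{\mathbf{B}} : \gamma \in F_r\}$ is dense). -/

import Mathlib

namespace FreeBoundary

open MeasureTheory Filter Topology

/-- The alphabet `{a₁^{±1}, …, a_r^{±1}}`: `(i, true)` is `aᵢ` and `(i, false)` is `aᵢ⁻¹`. These are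
the letters of Mathlib's `FreeGroup (Fin r)`. -/
abbrev Letter (r : ℕ) : Type := Fin r × Bool

/-- The inverse letter. -/
def Letter.inv {r : ℕ} (a : Letter r) : Letter r := (a.1, !a.2)

/-- The boundary `𝐁`: right-infinite reduced words. -/
def Boundary (r : ℕ) : Type := {ξ : ℕ → Letter r // ∀ n, ξ (n + 1) ≠ (ξ n).inv}

variable {r : ℕ}

instance : CoeFun (Boundary r) (fun _ => ℕ → Letter r) := ⟨fun ξ => ξ.1⟩

/-- The topology of `𝐁`: the product topology on infinite words, a basis of which is formed by the
sets `𝐁_u` of words with a given finite prefix `u`. -/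
instance : TopologicalSpace (Boundary r) :=
  inferInstanceAs (TopologicalSpace {ξ : ℕ → Letter r // ∀ n, ξ (n + 1) ≠ (ξ n).inv})

instance : MeasurableSpace (Boundary r) :=
  inferInstanceAs (MeasurableSpace {ξ : ℕ → Letter r // ∀ n, ξ (n + 1) ≠ (ξ n).inv})

/-- The σ-algebra on `𝐁` is the Borel σ-algebra. -/
instance : BorelSpace (Boundary r) :=
  inferInstanceAs (BorelSpace {ξ : ℕ → Letter r // ∀ n, ξ (n + 1) ≠ (ξ n).inv})

@[simp] theorem Letter.inv_inv (a : Letter r) : a.inv.inv = a := by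
  simp [Letter.inv]

theorem Letter.ne_inv (a : Letter r) : a ≠ a.inv := by
  intro h
  have := congrArg Prod.snd h
  simp [Letter.inv] at this

theorem Boundary.ext {ξ η : Boundary r} (h : ∀ n, ξ n = η n) : ξ = η := Subtype.ext (funext h)

theorem Boundary.succ_ne (ξ : Boundary r) (n : ℕ) : ξ (n + 1) ≠ (ξ n).inv := ξ.2 n

/-- The infinite word `ξ` without its first letter. -/
def Boundary.tail (ξ : Boundary r) : Boundary r := ⟨fun n => ξ (n + 1), fun n => ξ.2 (n + 1)⟩

/-- The infinite word `a ξ` when it is reduced. -/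
def Boundary.cons (a : Letter r) (ξ : Boundary r) (h : ξ 0 ≠ a.inv) : Boundary r :=
  ⟨fun n => Nat.casesOn n a (fun k => ξ k), fun n => by cases n with
    | zero => exact h
    | succ k => exact ξ.2 k⟩

/-- Left multiplication of an infinite reduced word by a letter, followed by reduction. -/
def Boundary.push (a : Letter r) (ξ : Boundary r) : Boundary r :=
  if h : ξ 0 = a.inv then ξ.tail else ξ.cons a h

theorem Boundary.push_apply (a : Letter r) (ξ : Boundary r) (n : ℕ) :
    Boundary.push a ξ n = if ξ 0 = a.inv then ξ (n + 1) else Nat.casesOn n a (fun k => ξ k) := by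
  unfold Boundary.push
  split_ifs <;> rfl

theorem Boundary.push_inv_push (a : Letter r) (ξ : Boundary r) :
    Boundary.push a.inv (Boundary.push a ξ) = ξ := by
  have h1 := ξ.2 0
  apply Boundary.ext
  intro n
  rw [Boundary.push_apply, Boundary.push_apply, Boundary.push_apply]
  simp only [Letter.inv_inv]
  by_cases h : ξ 0 = a.inv
  · rw [h, Letter.inv_inv] at h1
    cases n with
    | zero => simp_all
    | succ k => simp_all [Boundary.push_apply]
  · simp [h]

/-- The bijection of `𝐁` given by the generator `aᵢ`. -/
def genPerm (i : Fin r) : Equiv.Perm (Boundary r) where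
  toFun := Boundary.push (i, true)
  invFun := Boundary.push (i, false)
  left_inv ξ := Boundary.push_inv_push (i, true) ξ
  right_inv ξ := Boundary.push_inv_push (i, false) ξ

/-- The action of `F_r` on `𝐁` by left multiplication of reduced words. -/
instance : MulAction (FreeGroup (Fin r)) (Boundary r) :=
  MulAction.compHom (Boundary r) (FreeGroup.lift (genPerm (r := r)))

/-- The group element represented by a letter. -/
def Letter.toGroup (a : Letter r) : FreeGroup (Fin r) := FreeGroup.mk [a]

theorem Letter.toGroup_smul (a : Letter r) (ξ : Boundary r) :
    a.toGroup • ξ = Boundary.push a ξ := by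
  obtain ⟨i, b⟩ := a
  change FreeGroup.lift (genPerm (r := r)) (FreeGroup.mk [(i, b)]) ξ = _
  cases b
  · simp only [FreeGroup.lift_mk, List.map_cons, List.map_nil, List.prod_cons, List.prod_nil,
      mul_one, cond_false]
    rfl
  · simp only [FreeGroup.lift_mk, List.map_cons, List.map_nil, List.prod_cons, List.prod_nil,
      mul_one, cond_true]
    rfl

theorem Letter.toGroup_inv (a : Letter r) : a.toGroup⁻¹ = a.inv.toGroup := by
  simp [Letter.toGroup, Letter.inv, FreeGroup.inv_mk, FreeGroup.invRev]

theorem group_induction {p : FreeGroup (Fin r) → Prop} (h1 : p 1)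
    (hmul : ∀ (a : Letter r) (g), p g → p (a.toGroup * g)) (g : FreeGroup (Fin r)) : p g := by
  rw [← FreeGroup.mk_toWord (x := g)]
  induction g.toWord with
  | nil => exact h1
  | cons a L ih =>
    have := hmul a _ ih
    rwa [Letter.toGroup, FreeGroup.mul_mk] at this

/-- The vertex `u₁⋯uₙ` of the Cayley tree, for `ξ = u₁u₂u₃⋯`. -/
def Boundary.pre (ξ : Boundary r) (n : ℕ) : FreeGroup (Fin r) :=
  FreeGroup.mk (List.ofFn fun i : Fin n => ξ i)

/-- The distance of two vertices `g x₀`, `h x₀` of the Cayley tree, i.e. the word length of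
`g⁻¹ h`. -/
def vdist (g h : FreeGroup (Fin r)) : ℕ := (g⁻¹ * h).norm

/-- The Busemann function `β_ξ(g x₀, h x₀) = lim_n (d(g x₀, u₁⋯uₙ) - d(h x₀, u₁⋯uₙ))` where
`ξ = u₁u₂u₃⋯`; the sequence of integers is eventually constant
(see `eventually_eq_busemann` below). -/
noncomputable def busemann (ξ : Boundary r) (g h : FreeGroup (Fin r)) : ℤ :=
  limUnder atTop fun n : ℕ => (vdist g (ξ.pre n) : ℤ) - (vdist h (ξ.pre n) : ℤ)

theorem Boundary.norm_pre (ξ : Boundary r) (n : ℕ) : (ξ.pre n).norm = n := by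
  have : FreeGroup.IsReduced (List.ofFn fun i : Fin n => ξ i) := by
    unfold FreeGroup.IsReduced
    rw [List.isChain_iff_getElem]
    intro i hi h
    simp only [List.getElem_ofFn] at h ⊢
    by_contra hne
    apply ξ.2 i
    refine Prod.ext h.symm ?_
    simp only [Letter.inv]
    revert hne
    cases (ξ.1 i).2 <;> cases (ξ.1 (i+1)).2 <;> simp
  rw [FreeGroup.norm, Boundary.pre, FreeGroup.toWord_mk, this.reduce_eq, List.length_ofFn]

theorem Boundary.pre_succ (ξ : Boundary r) (n : ℕ) :
    ξ.pre (n + 1) = (ξ 0).toGroup * ξ.tail.pre n := by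
  rw [Boundary.pre, Boundary.pre, Letter.toGroup, FreeGroup.mul_mk, List.ofFn_succ]
  rfl

/-- `g u₁⋯uₙ` is the prefix of length `n + m` of `g ξ`, for large `n`. -/
def Shift (g : FreeGroup (Fin r)) (ξ : Boundary r) (m : ℤ) : Prop :=
  ∃ N : ℕ, ∀ n ≥ N, ∃ n' : ℕ, (n' : ℤ) = n + m ∧ g * ξ.pre n = (g • ξ).pre n'

theorem Shift.one (ξ : Boundary r) : Shift 1 ξ 0 :=
  ⟨0, fun n _ => ⟨n, by simp, by simp⟩⟩

theorem Shift.mul {g h : FreeGroup (Fin r)} {ξ : Boundary r} {m m' : ℤ}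
    (hg : Shift g (h • ξ) m') (hh : Shift h ξ m) : Shift (g * h) ξ (m' + m) := by
  obtain ⟨N, hN⟩ := hh
  obtain ⟨N', hN'⟩ := hg
  refine ⟨max N (N' + m.natAbs), fun n hn => ?_⟩
  obtain ⟨n1, h1, h2⟩ := hN n (le_trans (le_max_left _ _) hn)
  have := le_trans (le_max_right _ _) hn
  obtain ⟨n2, h3, h4⟩ := hN' n1 (by omega)
  exact ⟨n2, by omega, by rw [mul_assoc, h2, h4, mul_smul]⟩

theorem Shift.letter (a : Letter r) (ξ : Boundary r) :
    Shift a.toGroup ξ (if ξ 0 = a.inv then -1 else 1) := by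
  split_ifs with h
  · refine ⟨1, fun n hn => ⟨n - 1, by omega, ?_⟩⟩
    obtain ⟨n, rfl⟩ : ∃ k, n = k + 1 := ⟨n - 1, by omega⟩
    rw [Boundary.pre_succ, h, ← Letter.toGroup_inv, mul_inv_cancel_left, Letter.toGroup_smul]
    simp [Boundary.push, h]
  · refine ⟨0, fun n hn => ⟨n + 1, by omega, ?_⟩⟩
    rw [Boundary.pre_succ, Letter.toGroup_smul]
    simp only [Boundary.push, h, dite_false]
    rfl

theorem Shift.exists (g : FreeGroup (Fin r)) (ξ : Boundary r) : ∃ m, Shift g ξ m := by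
  induction g using group_induction with
  | h1 => exact ⟨0, Shift.one ξ⟩
  | hmul a g ih =>
    obtain ⟨m, hm⟩ := ih
    exact ⟨_, (Shift.letter a (g • ξ)).mul hm⟩

theorem Shift.eventually {g : FreeGroup (Fin r)} {ξ : Boundary r} {m : ℤ} (h : Shift g⁻¹ ξ m) :
    ∀ᶠ n : ℕ in atTop, (vdist g (ξ.pre n) : ℤ) = n + m := by
  obtain ⟨N, hN⟩ := h
  filter_upwards [eventually_ge_atTop N] with n hn
  obtain ⟨n', h1, h2⟩ := hN n hn
  rw [vdist, h2, Boundary.norm_pre, h1]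

theorem busemann_eq {g h : FreeGroup (Fin r)} {ξ : Boundary r} {m m' : ℤ}
    (hg : Shift g⁻¹ ξ m) (hh : Shift h⁻¹ ξ m') : busemann ξ g h = m - m' := by
  apply Tendsto.limUnder_eq
  apply tendsto_const_nhds.congr'
  filter_upwards [hg.eventually, hh.eventually] with n h1 h2
  rw [h1, h2]
  ring

/-- The sequence that defines the Busemann function is stationary. -/
theorem eventually_eq_busemann (ξ : Boundary r) (g h : FreeGroup (Fin r)) :
    ∀ᶠ n : ℕ in atTop,
      (vdist g (ξ.pre n) : ℤ) - (vdist h (ξ.pre n) : ℤ) = busemann ξ g h := by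
  obtain ⟨m, hm⟩ := Shift.exists g⁻¹ ξ
  obtain ⟨m', hm'⟩ := Shift.exists h⁻¹ ξ
  filter_upwards [hm.eventually, hm'.eventually] with n h1 h2
  rw [busemann_eq hm hm', h1, h2]
  ring

theorem busemann_one_mul (ξ : Boundary r) (g h : FreeGroup (Fin r)) :
    busemann ξ 1 (g * h) = busemann ξ 1 g + busemann (g⁻¹ • ξ) 1 h := by
  obtain ⟨m, hm⟩ := Shift.exists g⁻¹ ξ
  obtain ⟨m', hm'⟩ := Shift.exists h⁻¹ (g⁻¹ • ξ)
  have h1 (η : Boundary r) : Shift (1 : FreeGroup (Fin r))⁻¹ η 0 := by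
    rw [inv_one]; exact Shift.one η
  have h2 := hm'.mul hm
  rw [← mul_inv_rev] at h2
  rw [busemann_eq (h1 ξ) h2, busemann_eq (h1 ξ) hm, busemann_eq (h1 _) hm']
  ring

theorem busemann_one_one (ξ : Boundary r) : busemann ξ 1 1 = 0 := by
  have h1 : Shift (1 : FreeGroup (Fin r))⁻¹ ξ 0 := by rw [inv_one]; exact Shift.one ξ
  rw [busemann_eq h1 h1, sub_zero]

theorem busemann_one_letter (ξ : Boundary r) (a : Letter r) :
    busemann ξ 1 a.toGroup = if ξ 0 = a then 1 else -1 := by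
  have h1 : Shift (1 : FreeGroup (Fin r))⁻¹ ξ 0 := by rw [inv_one]; exact Shift.one ξ
  have h2 := Shift.letter a.inv ξ
  rw [← Letter.toGroup_inv] at h2
  rw [busemann_eq h1 h2, Letter.inv_inv]
  split_ifs <;> rfl

/-- The Poisson kernel `P(γ, ξ) = (2r-1)^{β_ξ(x₀, γ x₀)}`. -/
noncomputable def poisson (γ : FreeGroup (Fin r)) (ξ : Boundary r) : ℝ :=
  (2 * (r : ℝ) - 1) ^ busemann ξ 1 γ

theorem poisson_one (ξ : Boundary r) : poisson 1 ξ = 1 := by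
  rw [poisson, busemann_one_one, zpow_zero]

theorem Boundary.pos (ξ : Boundary r) : 0 < r := (ξ 0).1.pos

theorem base_pos (hr : 0 < r) : (0 : ℝ) < 2 * (r : ℝ) - 1 := by
  have : (1 : ℝ) ≤ r := by exact_mod_cast hr
  linarith

theorem poisson_pos (γ : FreeGroup (Fin r)) (ξ : Boundary r) : 0 < poisson γ ξ :=
  zpow_pos (base_pos ξ.pos) _

theorem poisson_mul (g h : FreeGroup (Fin r)) (ξ : Boundary r) :
    poisson (g * h) ξ = poisson g ξ * poisson h (g⁻¹ • ξ) := by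
  rw [poisson, busemann_one_mul, zpow_add₀ (base_pos ξ.pos).ne', poisson, poisson]

/-- `𝐁_u`: the infinite reduced words with prefix `u`. -/
def cylinder (u : FreeGroup (Fin r)) : Set (Boundary r) :=
  {ξ | ∀ i (h : i < u.toWord.length), ξ i = u.toWord[i]}

/-- The infinite words that have the same first `n` letters as `ξ`. -/
def Boundary.ball (ξ : Boundary r) (n : ℕ) : Set (Boundary r) := {η | ∀ i < n, η i = ξ i}

/-- The letters that may follow the letter `a` in a reduced word. -/
abbrev Next (a : Letter r) : Type := {b : Letter r // b ≠ a.inv}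

instance (a : Letter r) : Nonempty (Next a) := ⟨⟨a, a.ne_inv⟩⟩

/-- The infinite reduced word with first letter `a` in which a letter `c` at position `n` is
followed by `ω (n, c)`. -/
def path (a : Letter r) (ω : (p : ℕ × Letter r) → Next p.2) : ℕ → Letter r
  | 0 => a
  | n + 1 => ω (n, path a ω n)

/-- `path` as an element of the boundary. -/
def walk (x : Letter r × ((p : ℕ × Letter r) → Next p.2)) : Boundary r :=
  ⟨path x.1 x.2, fun n => (x.2 (n, path x.1 x.2 n)).2⟩

/-- The measure `μ_{x₀}`: the law of the random infinite reduced word whose first letter is uniform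
among the `2r` letters and whose every further letter is uniform among the `2r-1` letters that may
follow the preceding one. It is the Borel probability measure with
`μ_{x₀}(𝐁_u) = 1 / (2r (2r-1)^{|u|-1})` for `u ≠ e`, see `boundaryMeasure_cylinder` and
`eq_boundaryMeasure`. -/
noncomputable def boundaryMeasure (r : ℕ) : Measure (Boundary r) :=
  ((ProbabilityTheory.uniformOn (Set.univ : Set (Letter r))).prod
    (Measure.infinitePi fun p : ℕ × Letter r =>
      ProbabilityTheory.uniformOn (Set.univ : Set (Next p.2)))).map walk

theorem measurable_apply (n : ℕ) : Measurable fun ξ : Boundary r => ξ n :=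
  (measurable_pi_apply n).comp measurable_subtype_coe

theorem measurable_walk : Measurable (walk (r := r)) := by
  apply Measurable.subtype_mk
  rw [measurable_pi_iff]
  intro n
  induction n with
  | zero => exact measurable_fst
  | succ n ih =>
    change Measurable fun x : Letter r × ((p : ℕ × Letter r) → Next p.2) =>
      ((x.2 (n, path x.1 x.2 n)) : Letter r)
    apply measurable_to_countable'
    intro b
    have : (fun x : Letter r × ((p : ℕ × Letter r) → Next p.2) =>
        ((x.2 (n, path x.1 x.2 n)) : Letter r)) ⁻¹' {b} =
        ⋃ c : Letter r, {x | path x.1 x.2 n = c} ∩ {x | ((x.2 (n, c)) : Letter r) = b} := by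
      ext x
      simp
    rw [this]
    refine MeasurableSet.iUnion fun c => (ih (measurableSet_singleton c)).inter ?_
    have h2 : Measurable fun x : Letter r × ((p : ℕ × Letter r) → Next p.2) =>
        ((x.2 (n, c)) : Letter r) :=
      measurable_subtype_coe.comp ((measurable_pi_apply (n, c)).comp measurable_snd)
    exact h2 (measurableSet_singleton b)

instance : IsFiniteMeasure (ProbabilityTheory.uniformOn (Set.univ : Set (Letter r))) := by
  unfold ProbabilityTheory.uniformOn
  infer_instance

instance : IsFiniteMeasure (boundaryMeasure r) := by
  unfold boundaryMeasure
  infer_instance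

theorem uniformOn_univ_singleton {α : Type*} [Fintype α] [MeasurableSpace α]
    [MeasurableSingletonClass α] (a : α) :
    ProbabilityTheory.uniformOn (Set.univ : Set α) {a} = (Fintype.card α : ENNReal)⁻¹ := by
  rw [ProbabilityTheory.uniformOn_univ, Measure.count_singleton, one_div]

theorem card_next (a : Letter r) : Fintype.card (Next a) = 2 * r - 1 := by
  have : Fintype.card (Next a) = Fintype.card (Letter r) - 1 := by
    simp [Next]
  rw [this]
  simp [Letter, mul_comm]

theorem boundaryMeasure_ball (ξ : Boundary r) (n : ℕ) :
    boundaryMeasure r (ξ.ball (n + 1)) =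
      ((2 * r : ℕ) : ENNReal)⁻¹ * (((2 * r - 1 : ℕ) : ENNReal)⁻¹) ^ n := by
  classical
  have hm : MeasurableSet (ξ.ball (n + 1)) := by
    have : ξ.ball (n + 1) = ⋂ i, ⋂ (_ : i < n + 1), {η : Boundary r | η i = ξ i} := by
      ext η; simp [Boundary.ball]
    rw [this]
    exact MeasurableSet.iInter fun i => MeasurableSet.iInter fun _ =>
      measurable_apply i (measurableSet_singleton _)
  rw [boundaryMeasure, Measure.map_apply measurable_walk hm]
  let s : Finset (ℕ × Letter r) := (Finset.range n).image fun i => (i, ξ i)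
  let t : (p : ℕ × Letter r) → Set (Next p.2) := fun p => {b | (b : Letter r) = ξ (p.1 + 1)}
  have hpre : walk ⁻¹' (ξ.ball (n + 1)) = {ξ 0} ×ˢ Set.pi s t := by
    ext ⟨a, ω⟩
    have key : (∀ i < n + 1, path a ω i = ξ i) ↔
        a = ξ 0 ∧ ∀ i < n, ((ω (i, ξ i)) : Letter r) = ξ (i + 1) := by
      constructor
      · intro h
        refine ⟨h 0 (Nat.succ_pos n), fun i hi => ?_⟩
        have h1 := h i (by omega)
        have h2 := h (i + 1) (by omega)
        rw [← h1]
        exact h2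
      · rintro ⟨h0, h⟩ i
        induction i with
        | zero => intro _; exact h0
        | succ i ih =>
          intro hi
          rw [← h i (by omega)]
          change ((ω (i, path a ω i)) : Letter r) = _
          rw [ih (by omega)]
    change (∀ i < n + 1, path a ω i = ξ i) ↔ _
    rw [key]
    simp [s, t, Set.mem_pi]
  rw [hpre, Measure.prod_prod, Measure.infinitePi_pi _ (fun i _ => (Set.toFinite _).measurableSet),
    uniformOn_univ_singleton, Finset.prod_image (by simp)]
  have h1 : ∀ i ∈ Finset.range n, ProbabilityTheory.uniformOn
      (Set.univ : Set (Next (ξ i))) (t (i, ξ i)) = ((2 * r - 1 : ℕ) : ENNReal)⁻¹ := by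
    intro i _
    have : t (i, ξ i) = {⟨ξ (i + 1), ξ.succ_ne i⟩} := by
      ext b
      simp [t, Subtype.ext_iff]
    rw [this, uniformOn_univ_singleton, card_next]
  rw [Finset.prod_congr rfl h1, Finset.prod_const, Finset.card_range]
  simp [Letter, mul_comm]

theorem measurableSet_ball (ξ : Boundary r) (n : ℕ) : MeasurableSet (ξ.ball n) := by
  have : ξ.ball n = ⋂ i, ⋂ (_ : i < n), {η : Boundary r | η i = ξ i} := by
    ext η; simp [Boundary.ball]
  rw [this]
  exact MeasurableSet.iInter fun i => MeasurableSet.iInter fun _ =>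
    measurable_apply i (measurableSet_singleton _)

theorem isProbabilityMeasure_boundaryMeasure (hr : 0 < r) :
    IsProbabilityMeasure (boundaryMeasure r) := by
  have : Nonempty (Fin r) := ⟨⟨0, hr⟩⟩
  exact Measure.isProbabilityMeasure_map measurable_walk.aemeasurable

theorem exists_extension {L : List (Letter r)} (hL : FreeGroup.IsReduced L) (hne : L ≠ []) :
    ∃ ξ : Boundary r, ∀ i (h : i < L.length), ξ i = L[i] := by
  have hpos : 0 < L.length := List.length_pos_iff.2 hne
  refine ⟨⟨fun n => L[min n (L.length - 1)]'(by omega), fun n => ?_⟩, fun i h => ?_⟩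
  · by_cases hn : n + 1 < L.length
    · have e1 : min n (L.length - 1) = n := by omega
      have e2 : min (n + 1) (L.length - 1) = n + 1 := by omega
      simp only [e1, e2]
      unfold FreeGroup.IsReduced at hL
      rw [List.isChain_iff_getElem] at hL
      have := hL n hn
      intro h
      rw [h] at this
      simp [Letter.inv] at this
    · have e1 : min n (L.length - 1) = L.length - 1 := by omega
      have e2 : min (n + 1) (L.length - 1) = L.length - 1 := by omega
      simp only [e1, e2]
      exact Letter.ne_inv _
  · have e1 : min i (L.length - 1) = i := by omega
    simp only [e1]

theorem cylinder_eq_ball {u : FreeGroup (Fin r)} (hu : u ≠ 1) :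
    ∃ ξ : Boundary r, cylinder u = ξ.ball u.norm := by
  obtain ⟨ξ, hξ⟩ := exists_extension (FreeGroup.isReduced_toWord (x := u))
    (by rwa [Ne, FreeGroup.toWord_eq_nil_iff])
  refine ⟨ξ, ?_⟩
  ext η
  simp only [cylinder, Boundary.ball, Set.mem_ofPred_eq, FreeGroup.norm]
  exact forall_congr' fun i => forall_congr' fun h => by rw [hξ i h]

/-- `μ_{x₀}(𝐁_u) = 1 / (2r (2r-1)^{|u|-1})`. -/
theorem boundaryMeasure_cylinder {u : FreeGroup (Fin r)} (hu : u ≠ 1) :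
    boundaryMeasure r (cylinder u) =
      ENNReal.ofReal (1 / (2 * (r : ℝ) * (2 * (r : ℝ) - 1) ^ (u.norm - 1))) := by
  obtain ⟨ξ, hξ⟩ := cylinder_eq_ball hu
  obtain ⟨n, hn⟩ : ∃ n, u.norm = n + 1 :=
    Nat.exists_eq_succ_of_ne_zero fun h => hu (FreeGroup.norm_eq_zero.1 h)
  have hr := ξ.pos
  have hb := base_pos hr
  have hr' : (0 : ℝ) < r := by exact_mod_cast hr
  rw [hξ, hn, boundaryMeasure_ball, Nat.add_sub_cancel, one_div,
    ENNReal.ofReal_inv_of_pos (by positivity), ENNReal.ofReal_mul (by positivity),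
    ENNReal.ofReal_pow hb.le, ENNReal.mul_inv (by simp) (Or.inl ENNReal.ofReal_ne_top), ENNReal.inv_pow]
  have e1 : ENNReal.ofReal (2 * (r : ℝ)) = ((2 * r : ℕ) : ENNReal) := by
    rw [← ENNReal.ofReal_natCast]; push_cast; rfl
  have e2 : ENNReal.ofReal (2 * (r : ℝ) - 1) = ((2 * r - 1 : ℕ) : ENNReal) := by
    rw [← ENNReal.ofReal_natCast, Nat.cast_sub (by omega)]; push_cast; rfl
  rw [e1, e2]

theorem isPiSystem_ball (k : ℕ) :
    IsPiSystem {s : Set (Boundary r) | ∃ ξ n, k ≤ n ∧ s = Boundary.ball ξ n} := by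
  rintro _ ⟨ξ, n, hn, rfl⟩ _ ⟨ξ', n', hn', rfl⟩ ⟨η, h1, h2⟩
  refine ⟨η, max n n', le_trans hn (le_max_left _ _), ?_⟩
  ext ζ
  simp only [Boundary.ball, Set.mem_inter_iff, Set.mem_ofPred_eq] at *
  constructor
  · rintro ⟨h3, h4⟩ i hi
    rcases lt_max_iff.1 hi with hi | hi
    · rw [h3 i hi, h1 i hi]
    · rw [h4 i hi, h2 i hi]
  · intro h
    exact ⟨fun i hi => by rw [h i (lt_max_of_lt_left hi), h1 i hi],
      fun i hi => by rw [h i (lt_max_of_lt_right hi), h2 i hi]⟩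

theorem generateFrom_ball (k : ℕ) :
    (inferInstance : MeasurableSpace (Boundary r)) =
      MeasurableSpace.generateFrom
        {s : Set (Boundary r) | ∃ ξ n, k ≤ n ∧ s = Boundary.ball ξ n} := by
  apply le_antisymm
  · suffices h : @Measurable _ _ (MeasurableSpace.generateFrom
        {s : Set (Boundary r) | ∃ ξ n, k ≤ n ∧ s = Boundary.ball ξ n}) _
        (fun ξ : Boundary r => (ξ.1 : ℕ → Letter r)) from
      measurable_iff_comap_le.1 h
    refine @measurable_pi_lambda _ _ _ (MeasurableSpace.generateFrom
        {s : Set (Boundary r) | ∃ ξ n, k ≤ n ∧ s = Boundary.ball ξ n}) _ _ fun n => ?_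
    refine @measurable_to_countable' _ _ _ _ (MeasurableSpace.generateFrom
        {s : Set (Boundary r) | ∃ ξ n, k ≤ n ∧ s = Boundary.ball ξ n}) _ fun a => ?_
    have e : (fun ξ : Boundary r => ξ.1 n) ⁻¹' {a} =
        ⋃₀ ((fun ξ : Boundary r => ξ.ball (max k (n + 1))) '' {ξ | ξ.1 n = a}) := by
      ext η
      simp only [Set.mem_preimage, Set.mem_singleton_iff, Set.sUnion_image, Set.mem_ofPred_eq,
        Set.mem_iUnion, exists_prop]
      constructor
      · intro h
        exact ⟨η, h, fun _ _ => rfl⟩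
      · rintro ⟨ξ, h1, h2⟩
        rw [← h1]
        exact h2 n (lt_max_of_lt_right (Nat.lt_succ_self n))
    rw [e]
    refine MeasurableSet.sUnion ?_ ?_
    · refine Set.Countable.mono ?_ (Set.countable_range
        (fun v : Fin (max k (n + 1)) → Letter r => {η : Boundary r | ∀ i, η.1 i.1 = v i}))
      rintro _ ⟨ξ, _, rfl⟩
      refine ⟨fun i => ξ.1 i, ?_⟩
      ext η
      simp [Boundary.ball, Fin.forall_iff]
    · rintro _ ⟨ξ, _, rfl⟩
      exact MeasurableSpace.measurableSet_generateFrom ⟨ξ, _, le_max_left _ _, rfl⟩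
  · apply MeasurableSpace.generateFrom_le
    rintro _ ⟨ξ, n, _, rfl⟩
    exact measurableSet_ball ξ n

/-- `μ_{x₀}` is determined by its values on the sets `𝐁_u`. -/
theorem eq_boundaryMeasure (hr : 0 < r) (ν : Measure (Boundary r)) [IsProbabilityMeasure ν]
    (hν : ∀ u : FreeGroup (Fin r), u ≠ 1 → ν (cylinder u) =
      ENNReal.ofReal (1 / (2 * (r : ℝ) * (2 * (r : ℝ) - 1) ^ (u.norm - 1)))) :
    ν = boundaryMeasure r := by
  have := isProbabilityMeasure_boundaryMeasure hr
  refine ext_of_generate_finite _ (generateFrom_ball 1) (isPiSystem_ball 1) ?_ (by simp)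
  rintro _ ⟨ξ, n, hn, rfl⟩
  have hnorm := ξ.norm_pre n
  have hne : ξ.pre n ≠ 1 := by
    intro h
    rw [h, FreeGroup.norm_one] at hnorm
    omega
  have hc : cylinder (ξ.pre n) = ξ.ball n := by
    have : (ξ.pre n).toWord = List.ofFn fun i : Fin n => ξ.1 i := by
      rw [Boundary.pre, FreeGroup.toWord_mk]
      refine FreeGroup.reduce.red.sublist.eq_of_length ?_
      rw [← FreeGroup.toWord_mk, List.length_ofFn]
      exact hnorm
    ext η
    simp [cylinder, this, Boundary.ball]
  rw [← hc, hν _ hne, boundaryMeasure_cylinder hne]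

theorem measurable_push (a : Letter r) : Measurable (Boundary.push a) := by
  apply Measurable.subtype_mk (f := fun ξ => (Boundary.push a ξ).1)
  rw [measurable_pi_iff]
  intro n
  simp only [Boundary.push_apply]
  refine Measurable.ite (measurable_apply 0 (measurableSet_singleton _)) (measurable_apply _) ?_
  cases n with
  | zero => exact measurable_const
  | succ k => exact measurable_apply k

theorem measurable_letter_smul (a : Letter r) :
    Measurable fun ξ : Boundary r => a.toGroup • ξ := by
  simp only [Letter.toGroup_smul]
  exact measurable_push a

theorem measurable_smul' (g : FreeGroup (Fin r)) : Measurable fun ξ : Boundary r => g • ξ := by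
  induction g using group_induction with
  | h1 => simp only [one_smul]; exact measurable_id
  | hmul a g ih =>
    simp only [mul_smul]
    exact (measurable_letter_smul a).comp ih

theorem measurable_poisson (g : FreeGroup (Fin r)) : Measurable fun ξ : Boundary r =>
    poisson g ξ := by
  induction g using group_induction with
  | h1 => simp only [poisson_one]; exact measurable_const
  | hmul a g ih =>
    simp only [poisson_mul]
    refine Measurable.mul ?_ (ih.comp (measurable_smul' _))
    unfold poisson
    simp only [busemann_one_letter]
    exact (measurable_of_countable fun n : ℤ => (2 * (r : ℝ) - 1) ^ n).comp
      (Measurable.ite (measurable_apply 0 (measurableSet_singleton _)) measurable_const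
        measurable_const)

theorem push_zero (a : Letter r) (η : Boundary r) :
    Boundary.push a η 0 = if η 0 = a.inv then η 1 else a :=
  Boundary.push_apply a η 0

theorem push_zero_eq_iff (a : Letter r) (η : Boundary r) :
    Boundary.push a η 0 = a ↔ η 0 ≠ a.inv := by
  rw [push_zero]
  split_ifs with h
  · have := η.succ_ne 0
    rw [h, Letter.inv_inv] at this
    simp only [ne_eq, h, not_true_eq_false, iff_false]
    exact this
  · simp [h]

theorem push_preimage_ball_of_ne (a : Letter r) (ξ : Boundary r) (n : ℕ) (h : ξ 0 ≠ a) :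
    Boundary.push a ⁻¹' (ξ.ball (n + 1)) = (Boundary.push a.inv ξ).ball (n + 2) := by
  ext η
  have hi : ∀ i, Boundary.push a.inv ξ i = Nat.casesOn i a.inv (fun k => ξ k) := by
    intro i
    rw [Boundary.push_apply, Letter.inv_inv, if_neg h]
  constructor
  · intro hη i hi'
    have h0 : η 0 = a.inv := by
      by_contra hc
      apply h
      rw [← hη 0 (by omega), push_zero, if_neg hc]
    rw [hi]
    cases i with
    | zero => exact h0
    | succ k =>
      have := hη k (by omega)
      rwa [Boundary.push_apply, if_pos h0] at this
  · intro hη i hi'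
    have h0 : η 0 = a.inv := (hη 0 (by omega)).trans (hi 0)
    rw [Boundary.push_apply, if_pos h0, hη (i + 1) (by omega), hi]

theorem push_preimage_ball_of_eq (a : Letter r) (ξ : Boundary r) (n : ℕ) (h : ξ 0 = a) :
    Boundary.push a ⁻¹' (ξ.ball (n + 2)) = ξ.tail.ball (n + 1) := by
  ext η
  constructor
  · intro hη i hi'
    have h0 : η 0 ≠ a.inv := by
      rw [← push_zero_eq_iff, hη 0 (by omega), h]
    have := hη (i + 1) (by omega)
    rwa [Boundary.push_apply, if_neg h0] at this
  · intro hη i hi'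
    have h0 : η 0 ≠ a.inv := by
      rw [hη 0 (by omega), ← h]
      exact ξ.succ_ne 0
    rw [Boundary.push_apply, if_neg h0]
    cases i with
    | zero => exact h.symm
    | succ k => exact hη k (by omega)

theorem lintegral_poisson_letter_of_eq (a : Letter r) (s : Set (Boundary r))
    (hs : MeasurableSet s) (h : ∀ ξ ∈ s, ξ 0 = a) :
    ∫⁻ ξ in s, ENNReal.ofReal (poisson a.toGroup ξ) ∂boundaryMeasure r =
      ((2 * r - 1 : ℕ) : ENNReal) * boundaryMeasure r s := by
  rw [← setLIntegral_const]
  refine setLIntegral_congr_fun hs fun ξ hξ => ?_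
  have hr := a.1.pos
  simp only [poisson, busemann_one_letter, h ξ hξ, if_true, zpow_one]
  rw [← ENNReal.ofReal_natCast, Nat.cast_sub (by omega)]
  push_cast
  rfl

theorem lintegral_poisson_letter_of_ne (a : Letter r) (s : Set (Boundary r))
    (hs : MeasurableSet s) (h : ∀ ξ ∈ s, ξ 0 ≠ a) :
    ∫⁻ ξ in s, ENNReal.ofReal (poisson a.toGroup ξ) ∂boundaryMeasure r =
      ((2 * r - 1 : ℕ) : ENNReal)⁻¹ * boundaryMeasure r s := by
  rw [← setLIntegral_const]
  refine setLIntegral_congr_fun hs fun ξ hξ => ?_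
  have hr := a.1.pos
  simp only [poisson, busemann_one_letter, h ξ hξ, if_false, zpow_neg, zpow_one]
  rw [ENNReal.ofReal_inv_of_pos (base_pos hr), ← ENNReal.ofReal_natCast, Nat.cast_sub (by omega)]
  push_cast
  rfl

theorem measurableSet_first (a : Letter r) : MeasurableSet {ξ : Boundary r | ξ 0 = a} :=
  measurable_apply 0 (measurableSet_singleton a)

theorem boundaryMeasure_first (a : Letter r) :
    boundaryMeasure r {ξ | ξ 0 = a} = ((2 * r : ℕ) : ENNReal)⁻¹ := by
  obtain ⟨ξ, hξ⟩ := exists_extension (L := [a]) FreeGroup.IsReduced.singleton (by simp)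
  have h0 : ξ 0 = a := hξ 0 (by simp)
  have : {η : Boundary r | η 0 = a} = ξ.ball 1 := by
    ext η
    simp [Boundary.ball, h0]
  rw [this, boundaryMeasure_ball, pow_zero, mul_one]

theorem map_letter (a : Letter r) :
    (boundaryMeasure r).map (Boundary.push a) =
      (boundaryMeasure r).withDensity fun ξ => ENNReal.ofReal (poisson a.toGroup ξ) := by
  have hr := a.1.pos
  have := isProbabilityMeasure_boundaryMeasure hr
  have hq0 : ((2 * r - 1 : ℕ) : ENNReal) ≠ 0 := by
    rw [Nat.cast_ne_zero]; omega
  have hqt : ((2 * r - 1 : ℕ) : ENNReal) ≠ ⊤ := ENNReal.natCast_ne_top _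
  refine ext_of_generate_finite _ (generateFrom_ball 2) (isPiSystem_ball 2) ?_ ?_
  · rintro _ ⟨ξ, n, hn, rfl⟩
    obtain ⟨n, rfl⟩ : ∃ k, n = k + 2 := ⟨n - 2, by omega⟩
    rw [Measure.map_apply (measurable_push a) (measurableSet_ball _ _),
      withDensity_apply _ (measurableSet_ball _ _)]
    by_cases h : ξ 0 = a
    · rw [push_preimage_ball_of_eq a ξ n h, lintegral_poisson_letter_of_eq a _
        (measurableSet_ball _ _) (fun η hη => by rw [hη 0 (by omega), h]),
        boundaryMeasure_ball, boundaryMeasure_ball, pow_succ', mul_left_comm,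
        ← mul_assoc ((2 * r - 1 : ℕ) : ENNReal), ENNReal.mul_inv_cancel hq0 hqt, one_mul]
    · rw [push_preimage_ball_of_ne a ξ (n + 1) h, lintegral_poisson_letter_of_ne a _
        (measurableSet_ball _ _) (fun η hη => by rw [hη 0 (by omega)]; exact h),
        boundaryMeasure_ball, boundaryMeasure_ball, pow_succ', mul_left_comm]
  · rw [Measure.map_apply (measurable_push a) MeasurableSet.univ, Set.preimage_univ, measure_univ,
      withDensity_apply _ MeasurableSet.univ, Measure.restrict_univ,
      ← lintegral_add_compl _ (measurableSet_first a),
      lintegral_poisson_letter_of_eq a _ (measurableSet_first a) (fun _ h => h),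
      lintegral_poisson_letter_of_ne a _ (measurableSet_first a).compl (fun _ h => h),
      prob_compl_eq_one_sub (measurableSet_first a), boundaryMeasure_first]
    have e1 : (1 : ENNReal) - ((2 * r : ℕ) : ENNReal)⁻¹ =
        ((2 * r - 1 : ℕ) : ENNReal) * ((2 * r : ℕ) : ENNReal)⁻¹ := by
      have h2 : ((2 * r : ℕ) : ENNReal) = ((2 * r - 1 : ℕ) : ENNReal) + 1 := by
        rw [← Nat.cast_add_one]
        congr 1
        omega
      have h3 : ((2 * r : ℕ) : ENNReal) * ((2 * r : ℕ) : ENNReal)⁻¹ = 1 :=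
        ENNReal.mul_inv_cancel (by rw [Nat.cast_ne_zero]; omega) (ENNReal.natCast_ne_top _)
      conv_lhs => rw [← h3]
      nth_rw 1 [h2]
      rw [add_mul, one_mul, ENNReal.add_sub_cancel_right]
      simp
      omega
    rw [e1, ← mul_assoc, ENNReal.inv_mul_cancel hq0 hqt, ← add_mul, ← Nat.cast_add_one,
      Nat.sub_add_cancel (by omega)]
    exact (ENNReal.mul_inv_cancel (by rw [Nat.cast_ne_zero]; omega)
      (ENNReal.natCast_ne_top _)).symm

/-- The measure `μ_{x₀}` is quasi-invariant, with `d γ_* μ_{x₀} / d μ_{x₀} = P(γ, ·)`. -/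
theorem map_smul_boundaryMeasure (g : FreeGroup (Fin r)) :
    (boundaryMeasure r).map (fun ξ => g • ξ) =
      (boundaryMeasure r).withDensity fun ξ => ENNReal.ofReal (poisson g ξ) := by
  induction g using group_induction with
  | h1 => simp [poisson_one]
  | hmul a g ih =>
    have e : (fun ξ : Boundary r => (a.toGroup * g) • ξ) =
        (Boundary.push a) ∘ fun ξ => g • ξ := by
      ext1 ξ
      rw [mul_smul, Letter.toGroup_smul]
      rfl
    have hm : Measurable fun ξ : Boundary r => ENNReal.ofReal (poisson g ξ) :=
      (measurable_poisson g).ennreal_ofReal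
    have hm' : Measurable fun ξ : Boundary r => ENNReal.ofReal (poisson a.toGroup ξ) :=
      (measurable_poisson a.toGroup).ennreal_ofReal
    have hm'' : Measurable fun ξ : Boundary r =>
        ENNReal.ofReal (poisson g (a.toGroup⁻¹ • ξ)) :=
      hm.comp (measurable_smul' a.toGroup⁻¹)
    rw [e, ← Measure.map_map (measurable_push a) (measurable_smul' g), ih]
    ext s hs
    rw [Measure.map_apply (measurable_push a) hs,
      withDensity_apply _ (measurable_push a hs), withDensity_apply _ hs]
    have e2 : ∀ ξ : Boundary r, ENNReal.ofReal (poisson g ξ) =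
        ENNReal.ofReal (poisson g (a.toGroup⁻¹ • (Boundary.push a ξ))) := by
      intro ξ
      rw [← Letter.toGroup_smul, inv_smul_smul]
    rw [lintegral_congr e2]
    rw [← setLIntegral_map hs hm'' (measurable_push a), map_letter,
      setLIntegral_withDensity_eq_setLIntegral_mul _ hm' hm'' hs]
    refine lintegral_congr fun ξ => ?_
    rw [Pi.mul_apply, poisson_mul, ENNReal.ofReal_mul (poisson_pos _ _).le]

/-- The Hilbert space `L²(𝐁, μ_{x₀})`. -/
abbrev L2Boundary (r : ℕ) : Type := Lp ℂ 2 (boundaryMeasure r)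

theorem quasiMeasurePreserving_smul (g : FreeGroup (Fin r)) :
    Measure.QuasiMeasurePreserving (fun ξ : Boundary r => g • ξ) (boundaryMeasure r)
      (boundaryMeasure r) :=
  ⟨measurable_smul' g, by
    rw [map_smul_boundaryMeasure]; exact withDensity_absolutelyContinuous _ _⟩

/-- The function `ξ ↦ P(γ, ξ)^{1/2} f(γ⁻¹ ξ)`. -/
noncomputable def translate (γ : FreeGroup (Fin r)) (f : Boundary r → ℂ) (ξ : Boundary r) : ℂ :=
  ((poisson γ ξ) ^ (1 / 2 : ℝ) : ℝ) * f (γ⁻¹ • ξ)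

theorem translate_congr (γ : FreeGroup (Fin r)) {f f' : Boundary r → ℂ}
    (h : f =ᵐ[boundaryMeasure r] f') :
    translate γ f =ᵐ[boundaryMeasure r] translate γ f' := by
  filter_upwards [(quasiMeasurePreserving_smul γ⁻¹).ae_eq_comp h] with ξ hξ
  simp only [Function.comp_apply] at hξ
  rw [translate, translate, hξ]

theorem aestronglyMeasurable_translate (γ : FreeGroup (Fin r)) {f : Boundary r → ℂ}
    (h : AEStronglyMeasurable f (boundaryMeasure r)) :
    AEStronglyMeasurable (translate γ f) (boundaryMeasure r) := by
  refine AEStronglyMeasurable.mul ?_ (h.comp_quasiMeasurePreserving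
    (quasiMeasurePreserving_smul γ⁻¹))
  exact (Complex.measurable_ofReal.comp
    ((measurable_poisson γ).pow_const _)).aestronglyMeasurable

theorem eLpNorm_translate (γ : FreeGroup (Fin r)) {f : Boundary r → ℂ}
    (h : AEStronglyMeasurable f (boundaryMeasure r)) :
    eLpNorm (translate γ f) 2 (boundaryMeasure r) = eLpNorm f 2 (boundaryMeasure r) := by
  have hmk := h.ae_eq_mk
  rw [eLpNorm_congr_ae hmk, eLpNorm_congr_ae (translate_congr γ hmk)]
  have hf := h.stronglyMeasurable_mk
  generalize h.mk f = f' at hf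
  rw [eLpNorm_eq_lintegral_rpow_enorm_toReal (by simp) (by simp),
    eLpNorm_eq_lintegral_rpow_enorm_toReal (by simp) (by simp)]
  congr 1
  have hF : Measurable fun ξ => ‖f' ξ‖ₑ ^ (2 : ENNReal).toReal := hf.enorm.pow_const _
  have hF' : Measurable fun ξ => ‖f' (γ⁻¹ • ξ)‖ₑ ^ (2 : ENNReal).toReal :=
    hF.comp (measurable_smul' γ⁻¹)
  have e1 : ∀ ξ, ‖f' ξ‖ₑ ^ (2 : ENNReal).toReal =
      ‖f' (γ⁻¹ • (γ • ξ))‖ₑ ^ (2 : ENNReal).toReal := fun ξ => by rw [inv_smul_smul]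
  conv_rhs => rw [lintegral_congr e1]
  rw [← lintegral_map hF' (measurable_smul' γ), map_smul_boundaryMeasure,
    lintegral_withDensity_eq_lintegral_mul _ (measurable_poisson γ).ennreal_ofReal hF']
  refine lintegral_congr fun ξ => ?_
  have hp := (poisson_pos γ ξ).le
  rw [translate, Pi.mul_apply, enorm_mul, ENNReal.mul_rpow_of_nonneg _ _ (by simp)]
  congr 1
  rw [← ofReal_norm, Complex.norm_real, Real.norm_of_nonneg (Real.rpow_nonneg hp _),
    ENNReal.ofReal_rpow_of_nonneg (Real.rpow_nonneg hp _) (by simp), ← Real.rpow_mul hp]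
  simp

theorem memLp_translate (γ : FreeGroup (Fin r)) {f : Boundary r → ℂ}
    (h : MemLp f 2 (boundaryMeasure r)) : MemLp (translate γ f) 2 (boundaryMeasure r) :=
  ⟨aestronglyMeasurable_translate γ h.1, by rw [eLpNorm_translate γ h.1]; exact h.2⟩

/-- The operator `(π(γ) g)(ξ) = P(γ, ξ)^{1/2} g(γ⁻¹ ξ)` of `L²(𝐁, μ_{x₀})`. -/
noncomputable def translateLp (γ : FreeGroup (Fin r)) : L2Boundary r →ₗᵢ[ℂ] L2Boundary r where
  toFun g := (memLp_translate γ (Lp.memLp g)).toLp _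
  map_add' g h := by
    rw [← MemLp.toLp_add, MemLp.toLp_eq_toLp_iff]
    refine (translate_congr γ (Lp.coeFn_add g h)).trans (Eventually.of_forall fun ξ => ?_)
    simp [translate, mul_add]
  map_smul' c g := by
    rw [RingHom.id_apply, ← MemLp.toLp_const_smul, MemLp.toLp_eq_toLp_iff]
    refine (translate_congr γ (Lp.coeFn_smul c g)).trans (Eventually.of_forall fun ξ => ?_)
    simp [translate, mul_left_comm]
  norm_map' g := by
    change ‖(memLp_translate γ (Lp.memLp g)).toLp _‖ = ‖g‖
    rw [Lp.norm_toLp, eLpNorm_translate γ (Lp.aestronglyMeasurable g), Lp.norm_def]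

theorem coeFn_translateLp (γ : FreeGroup (Fin r)) (g : L2Boundary r) :
    translateLp γ g =ᵐ[boundaryMeasure r] translate γ g :=
  MemLp.coeFn_toLp (memLp_translate γ (Lp.memLp g))

theorem translate_mul (γ γ' : FreeGroup (Fin r)) (f : Boundary r → ℂ) :
    translate (γ * γ') f = translate γ (translate γ' f) := by
  ext1 ξ
  simp only [translate]
  rw [poisson_mul, Real.mul_rpow (poisson_pos _ _).le (poisson_pos _ _).le, mul_inv_rev, mul_smul,
    Complex.ofReal_mul, mul_assoc]

theorem translate_one (f : Boundary r → ℂ) : translate 1 f = f := by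
  ext1 ξ
  simp [translate, poisson_one]

theorem translateLp_mul (γ γ' : FreeGroup (Fin r)) (g : L2Boundary r) :
    translateLp (γ * γ') g = translateLp γ (translateLp γ' g) := by
  apply Lp.ext
  refine (coeFn_translateLp _ g).trans ?_
  rw [translate_mul]
  exact ((coeFn_translateLp γ _).trans (translate_congr γ (coeFn_translateLp γ' g))).symm

theorem translateLp_one (g : L2Boundary r) : translateLp 1 g = g := by
  apply Lp.ext
  refine (coeFn_translateLp _ g).trans ?_
  rw [translate_one]

/-- `translateLp` as a unitary isomorphism. -/
noncomputable def translateEquiv (γ : FreeGroup (Fin r)) : L2Boundary r ≃ₗᵢ[ℂ] L2Boundary r where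
  toLinearEquiv := LinearEquiv.ofLinearMap (translateLp γ).toLinearMap (translateLp γ⁻¹).toLinearMap
    (by ext1 g; simp [← translateLp_mul, translateLp_one])
    (by ext1 g; simp [← translateLp_mul, translateLp_one])
  norm_map' := (translateLp γ).norm_map'

/-- The quasi-regular representation `π : F_r → 𝒰(L²(𝐁, μ_{x₀}))`,
`(π(γ) g)(ξ) = P(γ, ξ)^{1/2} g(γ⁻¹ ξ)`. -/
noncomputable def quasiRegular (r : ℕ) :
    FreeGroup (Fin r) →* unitary (L2Boundary r →L[ℂ] L2Boundary r) :=
  Unitary.linearIsometryEquiv.symm.toMonoidHom.comp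
    { toFun := translateEquiv
      map_one' := by ext1 g; exact translateLp_one g
      map_mul' := fun γ γ' => by ext1 g; exact translateLp_mul γ γ' g }

theorem quasiRegular_apply (γ : FreeGroup (Fin r)) (g : L2Boundary r) :
    (quasiRegular r γ : L2Boundary r →L[ℂ] L2Boundary r) g =ᵐ[boundaryMeasure r]
      fun ξ => (((poisson γ ξ) ^ (1 / 2 : ℝ) : ℝ) : ℂ) * g (γ⁻¹ • ξ) :=
  coeFn_translateLp γ g

/-- The function `1_𝐁` as an element of `L²(𝐁, μ_{x₀})`. -/
noncomputable def oneB (r : ℕ) : L2Boundary r := Lp.const 2 (boundaryMeasure r) (1 : ℂ)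

section Representation

variable {G H : Type*} [Group G] [NormedAddCommGroup H] [InnerProductSpace ℂ H] [CompleteSpace H]

/-- A unitary representation is irreducible when the space is nonzero and its only closed
invariant subspaces are `0` and the whole space. -/
def IsIrreducibleUnitary (π : G →* unitary (H →L[ℂ] H)) : Prop :=
  Nontrivial H ∧ ∀ K : Submodule ℂ H, IsClosed (K : Set H) →
    (∀ γ : G, ∀ v ∈ K, (π γ : H →L[ℂ] H) v ∈ K) → K = ⊥ ∨ K = ⊤

/-- The von Neumann algebra `π(G)''` generated by a unitary representation: the bicommutant of the
set of operators `π(γ)`, which is closed under adjoints. -/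
def vonNeumannAlgebraOf (π : G →* unitary (H →L[ℂ] H)) : Set (H →L[ℂ] H) :=
  Set.centralizer (Set.centralizer (Set.range fun γ : G => (π γ : H →L[ℂ] H)))

/-- The vector `v` is cyclic: the linear span of its orbit is dense. -/
def IsCyclicVector (π : G →* unitary (H →L[ℂ] H)) (v : H) : Prop :=
  Dense (Submodule.span ℂ (Set.range fun γ : G => (π γ : H →L[ℂ] H) v) : Set H)

end Representation

end FreeBoundary

/-!
Write `q = 2r - 1` and consider the self-adjoint operator `A = ∑ π(a)`, the sum being over the `2r`
letters. The constant function is a positive eigenfunction of `A` with eigenvalue `2√q`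
(`sum_quasiRegular_oneB`), which is the case of equality in the Schur test: if `A f = 2√q f`, the
change of variable `ξ ↦ a ξ` shows that `∑ P(a, ξ)^{1/2} |f(a⁻¹ ξ) - f(ξ)|²` has integral zero, so `f`
is invariant under `F_r` (`invariant_of_eigenvector`). The action on the boundary is ergodic
(`ae_const_of_invariant`), so the eigenspace of `A` for `2√q` is the line of constants. Every
operator in the commutant of `π` commutes with `A` and therefore preserves this line. As the
commutant is closed under adjoints, the projection onto the line lies in the bicommutant.

The vector `1_𝐁` is cyclic because a vector orthogonal to its orbit has integral zero over each ball
of the boundary (`setIntegral_ball_eq_zero`), and an integrable function with that property vanishes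
(`ae_eq_zero_of_setIntegral_ball`). Ergodicity is proved with the same two steps. In both
cases the ball of words with a given prefix is the image, under the first letter of the prefix, of
the ball of words with the prefix shortened by that letter, and the density of the letter is
constant there; this gives an induction on the length of the prefix.

Irreducibility is then formal (`isIrreducibleUnitary_of_isCyclicVector`): the projection onto a closed
invariant subspace commutes with the projection onto the constants, so `1_𝐁` lies in that subspace
or is orthogonal to it.
-/

namespace FreeBoundary

open MeasureTheory Filter Topology
open scoped InnerProductSpace

variable {r : ℕ}

/-! ### Commutants of unitary representations -/

section Commutant

variable {G H : Type*} [Group G] [NormedAddCommGroup H] [InnerProductSpace ℂ H] [CompleteSpace H]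

theorem unitaryRep_inv (π : G →* unitary (H →L[ℂ] H)) (γ : G) :
    (π γ⁻¹ : H →L[ℂ] H) = star (π γ : H →L[ℂ] H) := by
  rw [map_inv]
  rfl

theorem inner_unitaryRep_right (π : G →* unitary (H →L[ℂ] H)) (γ : G) (v w : H) :
    ⟪v, (π γ : H →L[ℂ] H) w⟫_ℂ = ⟪(π γ⁻¹ : H →L[ℂ] H) v, w⟫_ℂ := by
  rw [unitaryRep_inv, ContinuousLinearMap.star_eq_adjoint, ContinuousLinearMap.adjoint_inner_left]

theorem adjoint_mem_commutant {π : G →* unitary (H →L[ℂ] H)} {T : H →L[ℂ] H}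
    (hT : T ∈ Set.centralizer (Set.range fun γ : G => (π γ : H →L[ℂ] H))) :
    star T ∈ Set.centralizer (Set.range fun γ : G => (π γ : H →L[ℂ] H)) := by
  rintro _ ⟨γ, rfl⟩
  have h := congrArg star (hT _ ⟨γ⁻¹, rfl⟩)
  simp only [star_mul, unitaryRep_inv, star_star] at h
  exact h.symm

/-- A projection commutes with every operator that, together with its adjoint, preserves its
range. -/
theorem starProjection_mul_comm {K : Submodule ℂ H} [K.HasOrthogonalProjection] {T : H →L[ℂ] H}
    (h : ∀ v ∈ K, T v ∈ K) (h' : ∀ v ∈ K, star T v ∈ K) :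
    T * K.starProjection = K.starProjection * T := by
  ext v
  refine (Submodule.eq_starProjection_of_mem_of_inner_eq_zero
    (h _ (K.starProjection_apply_mem v)) fun w hw => ?_).symm
  change ⟪T v - T (K.starProjection v), w⟫_ℂ = 0
  rw [← map_sub, ← ContinuousLinearMap.adjoint_inner_right]
  exact K.starProjection_inner_eq_zero _ _ (h' w hw)

/-- The projection onto a line lies in the bicommutant as soon as the commutant preserves that
line; the commutant being closed under adjoints, the orthogonal complement is then preserved
too. -/
theorem starProjection_span_mem_vonNeumannAlgebraOf {π : G →* unitary (H →L[ℂ] H)} {v : H}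
    (h : ∀ T ∈ Set.centralizer (Set.range fun γ : G => (π γ : H →L[ℂ] H)),
      T v ∈ Submodule.span ℂ {v}) :
    (Submodule.span ℂ {v}).starProjection ∈ vonNeumannAlgebraOf π := by
  have key : ∀ T ∈ Set.centralizer (Set.range fun γ : G => (π γ : H →L[ℂ] H)),
      ∀ w ∈ Submodule.span ℂ {v}, T w ∈ Submodule.span ℂ {v} := by
    intro T hT w hw
    obtain ⟨c, rfl⟩ := Submodule.mem_span_singleton.1 hw
    rw [map_smul]
    exact Submodule.smul_mem _ _ (h T hT)
  intro T hT
  exact starProjection_mul_comm (key T hT) (key _ (adjoint_mem_commutant hT))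

/-- A cyclic vector whose line has its projection in the bicommutant forces irreducibility: the
projection onto an invariant subspace `K` commutes with the one onto the line, so that the vector
lies in `K` or is orthogonal to `K`. -/
theorem isIrreducibleUnitary_of_isCyclicVector {π : G →* unitary (H →L[ℂ] H)} {v : H}
    (hv : v ≠ 0) (hc : IsCyclicVector π v)
    (hP : (Submodule.span ℂ {v}).starProjection ∈ vonNeumannAlgebraOf π) :
    IsIrreducibleUnitary π := by
  refine ⟨⟨v, 0, hv⟩, fun K hK hinv => ?_⟩
  have : CompleteSpace K := hK.completeSpace_coe
  have hcomm : K.starProjection ∈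
      Set.centralizer (Set.range fun γ : G => (π γ : H →L[ℂ] H)) := by
    rintro _ ⟨γ, rfl⟩
    refine starProjection_mul_comm (hinv γ) fun w hw => ?_
    rw [← unitaryRep_inv]
    exact hinv γ⁻¹ w hw
  have hmem : K.starProjection v ∈ Submodule.span ℂ {v} := by
    have h := DFunLike.congr_fun (hP _ hcomm) v
    simp only [mul_apply_eq_comp] at h
    rw [Submodule.starProjection_eq_self_iff.2 (Submodule.mem_span_singleton_self v)] at h
    rw [h]
    exact Submodule.starProjection_apply_mem _ _
  obtain ⟨c, hcv⟩ := Submodule.mem_span_singleton.1 hmem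
  by_cases h0 : c = 0
  · left
    rw [h0, zero_smul] at hcv
    have hvK : v ∈ Kᗮ := (Submodule.starProjection_apply_eq_zero_iff _).1 hcv.symm
    rw [Submodule.eq_bot_iff]
    intro k hk
    refine hc.eq_zero_of_inner_left ℂ fun w hw => ?_
    induction hw using Submodule.span_induction with
    | mem w hw =>
      obtain ⟨γ, rfl⟩ := hw
      rw [inner_unitaryRep_right]
      exact (Submodule.mem_orthogonal _ _).1 hvK _ (hinv _ k hk)
    | zero => exact inner_zero_right _
    | add x y _ _ hx hy => rw [inner_add_right, hx, hy, add_zero]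
    | smul a x _ hx => rw [inner_smul_right, hx, mul_zero]
  · right
    have hvK : v ∈ K := by
      rw [← inv_smul_smul₀ h0 v, hcv]
      exact K.smul_mem _ (K.starProjection_apply_mem v)
    have hle : Submodule.span ℂ (Set.range fun γ : G => (π γ : H →L[ℂ] H) v) ≤ K := by
      rw [Submodule.span_le]
      rintro _ ⟨γ, rfl⟩
      exact hinv γ v hvK
    rw [Submodule.eq_top_iff']
    intro x
    exact closure_minimal hle hK (hc x)

end Commutant

/-! ### Functions with vanishing integrals over balls -/

/-- The balls given by a nonempty prefix form a π-system that generates the σ-algebra. -/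
theorem ae_eq_zero_of_setIntegral_ball {f : Boundary r → ℂ}
    (hf : Integrable f (boundaryMeasure r)) (h0 : ∫ ξ, f ξ ∂boundaryMeasure r = 0)
    (h : ∀ n (ξ : Boundary r), ∫ η in ξ.ball (n + 1), f η ∂boundaryMeasure r = 0) :
    f =ᵐ[boundaryMeasure r] 0 := by
  refine hf.ae_eq_zero_of_forall_setIntegral_eq_zero fun s hs _ => ?_
  induction s, hs using
    MeasurableSpace.induction_on_inter (generateFrom_ball 1) (isPiSystem_ball 1) with
  | empty => simp
  | basic t ht =>
    obtain ⟨ξ, n, hn, rfl⟩ := ht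
    obtain ⟨n, rfl⟩ : ∃ k, n = k + 1 := ⟨n - 1, by omega⟩
    exact h n ξ
  | compl t ht ih =>
    rw [setIntegral_compl ht hf, h0, ih (measure_lt_top _ _), sub_zero]
  | iUnion t hd hm ih =>
    rw [integral_iUnion hm hd hf.integrableOn]
    simp [fun i => ih i (measure_lt_top _ _)]

/-! ### Half-densities -/

/-- The square root of the Radon–Nikodym derivative of `γ_* μ_{x₀}`. -/
noncomputable def halfDensity (γ : FreeGroup (Fin r)) (ξ : Boundary r) : ℝ :=
  poisson γ ξ ^ (1 / 2 : ℝ)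

theorem halfDensity_pos (γ : FreeGroup (Fin r)) (ξ : Boundary r) : 0 < halfDensity γ ξ :=
  Real.rpow_pos_of_pos (poisson_pos γ ξ) _

theorem halfDensity_mul_self (γ : FreeGroup (Fin r)) (ξ : Boundary r) :
    halfDensity γ ξ * halfDensity γ ξ = poisson γ ξ := by
  rw [halfDensity, ← Real.rpow_add (poisson_pos γ ξ)]
  norm_num

theorem halfDensity_mul_halfDensity_inv (γ : FreeGroup (Fin r)) (ξ : Boundary r) :
    halfDensity γ ξ * halfDensity γ⁻¹ (γ⁻¹ • ξ) = 1 := by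
  rw [halfDensity, halfDensity, ← Real.mul_rpow (poisson_pos _ _).le (poisson_pos _ _).le,
    ← poisson_mul, mul_inv_cancel, poisson_one, Real.one_rpow]

theorem halfDensity_letter (a : Letter r) (ξ : Boundary r) :
    halfDensity a.toGroup ξ =
      if ξ 0 = a then √(2 * (r : ℝ) - 1) else (√(2 * (r : ℝ) - 1))⁻¹ := by
  have hb := (base_pos ξ.pos).le
  rw [halfDensity, ← Real.sqrt_eq_rpow, poisson, busemann_one_letter]
  split_ifs
  · rw [zpow_one]
  · rw [zpow_neg, zpow_one, Real.sqrt_inv]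

theorem halfDensity_letter_le (hr : 2 ≤ r) (a : Letter r) (ξ : Boundary r) :
    halfDensity a.toGroup ξ ≤ √(2 * (r : ℝ) - 1) := by
  have hq : (1 : ℝ) ≤ 2 * (r : ℝ) - 1 := by
    have : (2 : ℝ) ≤ r := by exact_mod_cast hr
    linarith
  have hs1 : 1 ≤ √(2 * (r : ℝ) - 1) := Real.one_le_sqrt.2 hq
  rw [halfDensity_letter]
  split_ifs
  · exact le_rfl
  · exact (inv_le_one_of_one_le₀ hs1).trans hs1

theorem measurable_halfDensity (γ : FreeGroup (Fin r)) :
    Measurable fun ξ : Boundary r => halfDensity γ ξ :=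
  (measurable_poisson γ).pow_const _

/-- One letter contributes `√(2r-1)`, and each of the `2r-1` others contributes its inverse. -/
theorem sum_halfDensity_letter (ξ : Boundary r) :
    ∑ a : Letter r, halfDensity a.toGroup ξ = 2 * √(2 * (r : ℝ) - 1) := by
  have hb := base_pos ξ.pos
  have hs : √(2 * (r : ℝ) - 1) * √(2 * (r : ℝ) - 1) = 2 * (r : ℝ) - 1 :=
    Real.mul_self_sqrt hb.le
  have hs0 : √(2 * (r : ℝ) - 1) ≠ 0 := (Real.sqrt_pos.2 hb).ne'
  simp only [halfDensity_letter]
  rw [← Finset.add_sum_erase _ _ (Finset.mem_univ (ξ 0)), if_pos rfl,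
    Finset.sum_congr rfl fun a ha => if_neg (Finset.ne_of_mem_erase ha).symm,
    Finset.sum_const, Finset.card_erase_of_mem (Finset.mem_univ _), Finset.card_univ]
  have hc : ((Fintype.card (Letter r) - 1 : ℕ) : ℝ) = 2 * (r : ℝ) - 1 := by
    have : 1 ≤ r * 2 := by have := ξ.pos; omega
    simp [Letter, Nat.cast_sub this, mul_comm]
  have h1 : (2 * (r : ℝ) - 1) * (√(2 * (r : ℝ) - 1))⁻¹ = √(2 * (r : ℝ) - 1) := by
    rw [← div_eq_mul_inv, div_eq_iff hs0, hs]
  rw [nsmul_eq_mul, hc, h1]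
  ring

theorem sum_halfDensity_letter_inv (ξ : Boundary r) :
    ∑ a : Letter r, halfDensity a.toGroup⁻¹ ξ = 2 * √(2 * (r : ℝ) - 1) := by
  rw [← sum_halfDensity_letter ξ]
  simp only [Letter.toGroup_inv]
  exact (Function.Involutive.bijective Letter.inv_inv).sum_comp
    fun a : Letter r => halfDensity a.toGroup ξ

/-! ### Change of variable on the boundary -/

section ChangeOfVariable

variable {E : Type*} [NormedAddCommGroup E] [NormedSpace ℝ E]

theorem measurableEmbedding_smul (γ : FreeGroup (Fin r)) :
    MeasurableEmbedding fun ξ : Boundary r => γ • ξ :=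
  MeasurableEquiv.measurableEmbedding
    { toEquiv := MulAction.toPerm γ
      measurable_toFun := measurable_smul' γ
      measurable_invFun := measurable_smul' γ⁻¹ }

theorem setIntegral_poisson_smul (γ : FreeGroup (Fin r)) (F : Boundary r → E)
    {s : Set (Boundary r)} (hs : MeasurableSet s) :
    ∫ ξ in s, poisson γ ξ • F ξ ∂boundaryMeasure r =
      ∫ ξ in (fun ξ => γ • ξ) ⁻¹' s, F (γ • ξ) ∂boundaryMeasure r := by
  rw [← (measurableEmbedding_smul γ).setIntegral_map, map_smul_boundaryMeasure,
    setIntegral_withDensity_eq_setIntegral_toReal_smul (measurable_poisson γ).ennreal_ofReal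
      (by simp) _ hs]
  simp only [ENNReal.toReal_ofReal (poisson_pos _ _).le]

theorem integral_poisson_smul (γ : FreeGroup (Fin r)) (F : Boundary r → E) :
    ∫ ξ, poisson γ ξ • F ξ ∂boundaryMeasure r = ∫ ξ, F (γ • ξ) ∂boundaryMeasure r := by
  simpa using setIntegral_poisson_smul γ F MeasurableSet.univ

end ChangeOfVariable

theorem letter_smul_preimage_first (a : Letter r) :
    (fun ξ : Boundary r => a.toGroup • ξ) ⁻¹' {ξ | ξ 0 = a} = {ξ | ξ 0 = a.inv}ᶜ := by
  ext ξ
  simp only [Set.mem_preimage, Letter.toGroup_smul]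
  exact push_zero_eq_iff a ξ

theorem letter_smul_preimage_ball (ξ : Boundary r) (n : ℕ) :
    (fun η : Boundary r => (ξ 0).toGroup • η) ⁻¹' (ξ.ball (n + 2)) = ξ.tail.ball (n + 1) := by
  simp only [Letter.toGroup_smul]
  exact push_preimage_ball_of_eq _ ξ n rfl

theorem ball_one (ξ : Boundary r) : ξ.ball 1 = {η | η 0 = ξ 0} := by
  ext η
  simp [Boundary.ball]

/-! ### Ergodicity -/

/-- The density of the letter `a` is the constant `2r-1` on words beginning with `a`. -/
theorem setIntegral_smul_letter {f : Boundary r → ℂ} {a : Letter r}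
    (hinv : (fun ξ => f (a.toGroup • ξ)) =ᵐ[boundaryMeasure r] f)
    {s : Set (Boundary r)} (hs : MeasurableSet s) (hsa : ∀ ξ ∈ s, ξ 0 = a) :
    ∫ ξ in (fun ξ => a.toGroup • ξ) ⁻¹' s, f ξ ∂boundaryMeasure r =
      ((2 * (r : ℝ) - 1 : ℝ) : ℂ) * ∫ ξ in s, f ξ ∂boundaryMeasure r := by
  rw [← integral_const_mul, ← integral_congr_ae (ae_restrict_of_ae hinv),
    ← setIntegral_poisson_smul _ _ hs]
  refine setIntegral_congr_fun hs fun ξ hξ => ?_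
  simp only [poisson, busemann_one_letter, hsa ξ hξ, if_true, zpow_one, Complex.real_smul]

/-- The action of `F_r` on its boundary is ergodic. For an invariant function of mean zero, with
integral `T a` over the words that begin with `a`, invariance under `a` gives
`-T a⁻¹ = (2r-1) T a` for every letter, hence `T = 0`; the integrals over smaller balls vanish by
induction, because the inverse of its first letter carries a ball to a larger one. -/
theorem ae_const_of_invariant (hr : 2 ≤ r) {f : Boundary r → ℂ}
    (hf : Integrable f (boundaryMeasure r))
    (hinv : ∀ a : Letter r, (fun ξ => f (a.toGroup • ξ)) =ᵐ[boundaryMeasure r] f) :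
    f =ᵐ[boundaryMeasure r] fun _ => ∫ ξ, f ξ ∂boundaryMeasure r := by
  have := isProbabilityMeasure_boundaryMeasure (r := r) (by omega)
  set c := ∫ ξ, f ξ ∂boundaryMeasure r with hc
  let g : Boundary r → ℂ := fun ξ => f ξ - c
  have hg : Integrable g (boundaryMeasure r) := hf.sub (integrable_const c)
  have hg0 : ∫ ξ, g ξ ∂boundaryMeasure r = 0 := by
    rw [integral_sub hf (integrable_const c), integral_const]
    simp [hc]
  have hginv (a : Letter r) : (fun ξ => g (a.toGroup • ξ)) =ᵐ[boundaryMeasure r] g := by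
    filter_upwards [hinv a] with ξ hξ
    simp only [g, hξ]
  have hq : (3 : ℝ) ≤ 2 * (r : ℝ) - 1 := by
    have : (2 : ℝ) ≤ r := by exact_mod_cast hr
    linarith
  have hfirst (a : Letter r) : ∫ ξ in {ξ | ξ 0 = a}, g ξ ∂boundaryMeasure r = 0 := by
    have h1 (b : Letter r) : -∫ ξ in {ξ | ξ 0 = b.inv}, g ξ ∂boundaryMeasure r =
        ((2 * (r : ℝ) - 1 : ℝ) : ℂ) * ∫ ξ in {ξ | ξ 0 = b}, g ξ ∂boundaryMeasure r := by
      rw [← setIntegral_smul_letter (hginv b) (measurableSet_first b) (fun _ h => h),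
        letter_smul_preimage_first, setIntegral_compl (measurableSet_first _) hg, hg0, zero_sub]
    have h2 := h1 a
    have h3 := h1 a.inv
    rw [Letter.inv_inv] at h3
    set q : ℝ := 2 * (r : ℝ) - 1
    -- The two relations combine to `T a = q² T a`.
    have h4 : ((q * q - 1 : ℝ) : ℂ) * ∫ ξ in {ξ | ξ 0 = a}, g ξ ∂boundaryMeasure r = 0 := by
      push_cast
      linear_combination h3 - (q : ℂ) * h2
    refine (mul_eq_zero.1 h4).resolve_left ?_
    rw [Complex.ofReal_eq_zero]
    nlinarith [hq]
  have hz : g =ᵐ[boundaryMeasure r] 0 := by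
    refine ae_eq_zero_of_setIntegral_ball hg hg0 fun n => ?_
    induction n with
    | zero => intro ξ; rw [zero_add, ball_one]; exact hfirst _
    | succ n ih =>
      intro ξ
      have h := setIntegral_smul_letter (hginv (ξ 0)) (measurableSet_ball ξ (n + 2))
        (fun η hη => hη 0 (by omega))
      rw [letter_smul_preimage_ball, ih] at h
      refine (mul_eq_zero.1 h.symm).resolve_left ?_
      rw [Complex.ofReal_eq_zero]
      linarith
  filter_upwards [hz] with ξ hξ
  exact sub_eq_zero.1 hξ

/-! ### Cyclicity of the constant function -/

theorem integrable_L2Boundary (f : L2Boundary r) : Integrable f (boundaryMeasure r) :=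
  (Lp.memLp f).integrable one_le_two

theorem inner_oneB (f : L2Boundary r) : ⟪oneB r, f⟫_ℂ = ∫ ξ, f ξ ∂boundaryMeasure r := by
  rw [L2.inner_def]
  refine integral_congr_ae ?_
  filter_upwards [Lp.coeFn_const 2 (boundaryMeasure r) (1 : ℂ)] with ξ hξ
  rw [oneB, hξ]
  simp

/-- The integral of `π(γ⁻¹) f` over `γ⁻¹ s`, expressed on `s`; since `π(γ⁻¹)` carries only half of the
density of `γ`, the other half remains. -/
theorem setIntegral_quasiRegular_inv (γ : FreeGroup (Fin r)) (f : L2Boundary r)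
    {s : Set (Boundary r)} (hs : MeasurableSet s) :
    ∫ ξ in (fun ξ => γ • ξ) ⁻¹' s,
        (quasiRegular r γ⁻¹ : L2Boundary r →L[ℂ] L2Boundary r) f ξ ∂boundaryMeasure r =
      ∫ ξ in s, halfDensity γ ξ * f ξ ∂boundaryMeasure r := by
  have h := setIntegral_poisson_smul γ
    (fun ξ => (halfDensity γ⁻¹ (γ⁻¹ • ξ) : ℂ) * f ξ) hs
  simp only [inv_smul_smul] at h
  rw [integral_congr_ae (ae_restrict_of_ae (quasiRegular_apply γ⁻¹ f)), inv_inv]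
  refine h.symm.trans (setIntegral_congr_fun hs fun ξ _ => ?_)
  have h1 := halfDensity_mul_halfDensity_inv γ ξ
  simp only [← halfDensity_mul_self γ ξ, Complex.real_smul]
  rw [← mul_assoc, ← Complex.ofReal_mul, mul_assoc, h1, mul_one]

/-- If all translates of `f` have mean zero, then `f` has integral zero over every ball. For the ball
of the words that begin with `a` this holds because `P(a, ·)^{1/2}` takes one value on that ball and
another one off it. The other balls follow by induction on the prefix length, as the translate of `f` by the
inverse of the first letter satisfies the same hypothesis. -/
theorem setIntegral_ball_eq_zero (hr : 2 ≤ r) (n : ℕ) (f : L2Boundary r)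
    (h : ∀ γ, ∫ ξ, (quasiRegular r γ : L2Boundary r →L[ℂ] L2Boundary r) f ξ
      ∂boundaryMeasure r = 0) (ξ : Boundary r) :
    ∫ η in ξ.ball (n + 1), f η ∂boundaryMeasure r = 0 := by
  have hq : (1 : ℝ) < 2 * (r : ℝ) - 1 := by
    have : (2 : ℝ) ≤ r := by exact_mod_cast hr
    linarith
  have hs1 : 1 < √(2 * (r : ℝ) - 1) := Real.lt_sqrt_of_sq_lt (by simpa using hq)
  set s := √(2 * (r : ℝ) - 1) with hs
  have hin (f : L2Boundary r) (t : Set (Boundary r)) (ht : MeasurableSet t) (a : Letter r)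
      (hta : ∀ η ∈ t, η 0 = a) :
      ∫ η in t, halfDensity a.toGroup η * f η ∂boundaryMeasure r =
        s * ∫ η in t, f η ∂boundaryMeasure r := by
    rw [← integral_const_mul]
    refine setIntegral_congr_fun ht fun η hη => ?_
    simp only [halfDensity_letter, hta η hη, if_true, hs]
  induction n generalizing f ξ with
  | zero =>
    have h0 := h 1
    rw [map_one] at h0
    change ∫ η, f η ∂boundaryMeasure r = 0 at h0
    have hf := integrable_L2Boundary f
    have hm := measurableSet_first (ξ 0)
    have h1 := setIntegral_quasiRegular_inv (ξ 0).toGroup f MeasurableSet.univ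
    rw [Set.preimage_univ, setIntegral_univ, h, setIntegral_univ] at h1
    have hint : Integrable (fun η => (halfDensity (ξ 0).toGroup η : ℂ) * f η)
        (boundaryMeasure r) := by
      refine hf.bdd_mul (c := s) (Complex.measurable_ofReal.comp
        (measurable_halfDensity _)).aestronglyMeasurable (Eventually.of_forall fun η => ?_)
      rw [Complex.norm_real, Real.norm_of_nonneg (halfDensity_pos _ _).le]
      exact halfDensity_letter_le hr _ _
    rw [← integral_add_compl hm hint, hin f _ hm (ξ 0) (fun _ h => h)] at h1
    have h2 : ∫ η in {η : Boundary r | η 0 = ξ 0}ᶜ,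
        halfDensity (ξ 0).toGroup η * f η ∂boundaryMeasure r =
        ((s⁻¹ : ℝ) : ℂ) * ∫ η in {η : Boundary r | η 0 = ξ 0}ᶜ, f η ∂boundaryMeasure r := by
      rw [← integral_const_mul]
      refine setIntegral_congr_fun hm.compl fun η hη => ?_
      have hη' : ¬ η 0 = ξ 0 := hη
      simp only [halfDensity_letter, hη', if_false, hs]
    rw [h2, setIntegral_compl hm hf, h0, zero_sub] at h1
    rw [zero_add, ball_one]
    have h3 : ((s - s⁻¹ : ℝ) : ℂ) * ∫ η in {η : Boundary r | η 0 = ξ 0}, f η ∂boundaryMeasure r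
        = 0 := by
      rw [Complex.ofReal_sub]
      linear_combination -h1
    refine (mul_eq_zero.1 h3).resolve_left ?_
    rw [Complex.ofReal_eq_zero]
    have := inv_lt_one_of_one_lt₀ hs1
    linarith
  | succ n ih =>
    have h1 := setIntegral_quasiRegular_inv (ξ 0).toGroup f (measurableSet_ball ξ (n + 2))
    rw [letter_smul_preimage_ball, ih, hin f _ (measurableSet_ball ξ (n + 2)) (ξ 0)
      (fun η hη => hη 0 (by omega))] at h1
    · refine (mul_eq_zero.1 h1.symm).resolve_left ?_
      rw [Complex.ofReal_eq_zero]
      linarith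
    · intro γ
      have h2 := h (γ * (ξ 0).toGroup⁻¹)
      rw [map_mul] at h2
      exact h2

theorem isCyclicVector_oneB (hr : 2 ≤ r) : IsCyclicVector (quasiRegular r) (oneB r) := by
  rw [IsCyclicVector, Submodule.dense_iff_topologicalClosure_eq_top,
    Submodule.topologicalClosure_eq_top_iff, Submodule.eq_bot_iff]
  intro f hf
  have h (γ) : ∫ ξ, (quasiRegular r γ : L2Boundary r →L[ℂ] L2Boundary r) f ξ
      ∂boundaryMeasure r = 0 := by
    rw [← inner_oneB, inner_unitaryRep_right]
    exact (Submodule.mem_orthogonal _ _).1 hf _ (Submodule.subset_span ⟨γ⁻¹, rfl⟩)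
  have h1 := h 1
  rw [map_one] at h1
  exact (Lp.eq_zero_iff_ae_eq_zero).2 (ae_eq_zero_of_setIntegral_ball (integrable_L2Boundary f) h1
    fun n => setIntegral_ball_eq_zero hr n f h)

/-! ### The top eigenspace of the sum of the generators -/

/-- The Dirichlet form of a weighted star, at a value `z` that satisfies the eigenvalue equation. -/
theorem sum_mul_norm_sub_sq {ι : Type*} [Fintype ι] {w : ι → ℝ} {F : ι → ℂ} {z : ℂ} {t : ℝ}
    (hw : ∑ i, w i = t) (hF : ∑ i, (w i : ℂ) * F i = t * z) :
    ∑ i, w i * ‖F i - z‖ ^ 2 = ∑ i, w i * ‖F i‖ ^ 2 - t * ‖z‖ ^ 2 := by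
  have h := congrArg (fun x : ℂ => (x * (starRingEnd ℂ) z).re) hF
  simp only [Finset.sum_mul, Complex.re_sum, mul_assoc, Complex.re_ofReal_mul,
    Complex.mul_conj, Complex.ofReal_re] at h
  simp only [Complex.sq_norm, Complex.normSq_sub, mul_sub, mul_add, Finset.sum_sub_distrib,
    Finset.sum_add_distrib, ← Finset.sum_mul, hw]
  simp only [mul_left_comm _ (2 : ℝ), ← Finset.mul_sum, h]
  ring

theorem integrable_norm_sq (f : L2Boundary r) :
    Integrable (fun ξ => ‖f ξ‖ ^ 2) (boundaryMeasure r) :=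
  (Lp.memLp f).integrable_norm_pow two_ne_zero

/-- Equality in the Schur test. If `f` is an eigenvector of `∑ π(a)` for the eigenvalue of `1_𝐁`,
then `∑ P(a, ξ)^{1/2} |f(a⁻¹ ξ) - f(ξ)|²` has integral zero, so that `f` is invariant. -/
theorem invariant_of_eigenvector (hr : 2 ≤ r) {f : L2Boundary r}
    (hf : ∑ a : Letter r, (quasiRegular r a.toGroup : L2Boundary r →L[ℂ] L2Boundary r) f =
      ((2 * √(2 * (r : ℝ) - 1) : ℝ) : ℂ) • f) (a : Letter r) :
    (fun ξ => f (a.toGroup • ξ)) =ᵐ[boundaryMeasure r] f := by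
  have hbound (g : L2Boundary r) (b : Letter r) (γ : FreeGroup (Fin r)) :
      Integrable (fun ξ => halfDensity b.toGroup (γ • ξ) * ‖g ξ‖ ^ 2) (boundaryMeasure r) := by
    refine (integrable_norm_sq g).bdd_mul (c := √(2 * (r : ℝ) - 1))
      ((measurable_halfDensity _).comp (measurable_smul' γ)).aestronglyMeasurable
      (Eventually.of_forall fun ξ => ?_)
    rw [Real.norm_of_nonneg (halfDensity_pos _ _).le]
    exact halfDensity_letter_le hr _ _
  have hint (b : Letter r) : Integrable
      (fun ξ => halfDensity b.toGroup ξ * ‖f (b.toGroup⁻¹ • ξ)‖ ^ 2) (boundaryMeasure r) := by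
    refine (hbound ((quasiRegular r b.toGroup : L2Boundary r →L[ℂ] L2Boundary r) f) b.inv
      b.toGroup⁻¹).congr ?_
    filter_upwards [quasiRegular_apply b.toGroup f] with ξ hξ
    have h1 := halfDensity_mul_halfDensity_inv b.toGroup ξ
    rw [hξ, ← Letter.toGroup_inv, ← halfDensity, norm_mul, Complex.norm_real,
      Real.norm_of_nonneg (halfDensity_pos _ _).le]
    linear_combination halfDensity b.toGroup ξ * ‖f (b.toGroup⁻¹ • ξ)‖ ^ 2 * h1
  have hint' (b : Letter r) : Integrable
      (fun ξ => halfDensity b.toGroup⁻¹ ξ * ‖f ξ‖ ^ 2) (boundaryMeasure r) := by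
    simpa [Letter.toGroup_inv] using hbound f b.inv 1
  have hchange (b : Letter r) :
      ∫ ξ, halfDensity b.toGroup ξ * ‖f (b.toGroup⁻¹ • ξ)‖ ^ 2 ∂boundaryMeasure r =
        ∫ ξ, halfDensity b.toGroup⁻¹ ξ * ‖f ξ‖ ^ 2 ∂boundaryMeasure r := by
    have h := integral_poisson_smul b.toGroup
      (fun ξ => halfDensity b.toGroup⁻¹ (b.toGroup⁻¹ • ξ) * ‖f (b.toGroup⁻¹ • ξ)‖ ^ 2)
    simp only [inv_smul_smul] at h
    rw [← h]
    refine integral_congr_ae (Eventually.of_forall fun ξ => ?_)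
    have h1 := halfDensity_mul_halfDensity_inv b.toGroup ξ
    simp only [smul_eq_mul, ← halfDensity_mul_self b.toGroup ξ]
    linear_combination -(halfDensity b.toGroup ξ * ‖f (b.toGroup⁻¹ • ξ)‖ ^ 2) * h1
  -- The energy density; its two parts below have the same integral by the change of variable.
  let D : Boundary r → ℝ := fun ξ =>
    ∑ b : Letter r, halfDensity b.toGroup ξ * ‖f (b.toGroup⁻¹ • ξ) - f ξ‖ ^ 2
  have heig : ∀ᵐ ξ ∂boundaryMeasure r,
      ∑ b : Letter r, (halfDensity b.toGroup ξ : ℂ) * f (b.toGroup⁻¹ • ξ) =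
        ((2 * √(2 * (r : ℝ) - 1) : ℝ) : ℂ) * f ξ := by
    have h1 := Lp.coeFn_smul ((2 * √(2 * (r : ℝ) - 1) : ℝ) : ℂ) f
    rw [← hf] at h1
    filter_upwards [h1, Lp.coeFn_finsetSum Finset.univ fun b : Letter r =>
      (quasiRegular r b.toGroup : L2Boundary r →L[ℂ] L2Boundary r) f,
      ae_all_iff.2 fun b : Letter r => quasiRegular_apply b.toGroup f] with ξ h1 h2 h3
    rw [h2] at h1
    simpa [h3, halfDensity] using h1
  have hD : D =ᵐ[boundaryMeasure r] fun ξ =>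
      ∑ b : Letter r, halfDensity b.toGroup ξ * ‖f (b.toGroup⁻¹ • ξ)‖ ^ 2 -
        ∑ b : Letter r, halfDensity b.toGroup⁻¹ ξ * ‖f ξ‖ ^ 2 := by
    filter_upwards [heig] with ξ hξ
    rw [← Finset.sum_mul, sum_halfDensity_letter_inv]
    exact sum_mul_norm_sub_sq (sum_halfDensity_letter ξ) hξ
  have hi1 := integrable_finsetSum Finset.univ fun b _ => hint b
  have hi2 := integrable_finsetSum Finset.univ fun b _ => hint' b
  have hD0 : ∫ ξ, D ξ ∂boundaryMeasure r = 0 := by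
    rw [integral_congr_ae hD, integral_sub hi1 hi2, integral_finsetSum _ fun b _ => hint b,
      integral_finsetSum _ fun b _ => hint' b, Finset.sum_congr rfl fun b _ => hchange b, sub_self]
  have hnn (ξ : Boundary r) (b : Letter r) :
      0 ≤ halfDensity b.toGroup ξ * ‖f (b.toGroup⁻¹ • ξ) - f ξ‖ ^ 2 :=
    mul_nonneg (halfDensity_pos _ _).le (sq_nonneg _)
  have hDz := (integral_eq_zero_iff_of_nonneg (fun ξ => Finset.sum_nonneg fun b _ => hnn ξ b)
    ((hi1.sub hi2).congr hD.symm)).1 hD0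
  filter_upwards [hDz] with ξ hξ
  have h1 := (Finset.sum_eq_zero_iff_of_nonneg fun b _ => hnn ξ b).1 hξ a.inv (Finset.mem_univ _)
  rw [← Letter.toGroup_inv, inv_inv] at h1
  have h2 := (mul_eq_zero.1 h1).resolve_left (halfDensity_pos _ _).ne'
  exact sub_eq_zero.1 (norm_eq_zero.1 (pow_eq_zero_iff two_ne_zero |>.1 h2))

theorem sum_quasiRegular_oneB :
    ∑ a : Letter r, (quasiRegular r a.toGroup : L2Boundary r →L[ℂ] L2Boundary r) (oneB r) =
      ((2 * √(2 * (r : ℝ) - 1) : ℝ) : ℂ) • oneB r := by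
  have hone : oneB r =ᵐ[boundaryMeasure r] fun _ => 1 := Lp.coeFn_const _ _ _
  apply Lp.ext
  filter_upwards [hone, Lp.coeFn_smul ((2 * √(2 * (r : ℝ) - 1) : ℝ) : ℂ) (oneB r),
    Lp.coeFn_finsetSum Finset.univ fun b : Letter r =>
      (quasiRegular r b.toGroup : L2Boundary r →L[ℂ] L2Boundary r) (oneB r),
    ae_all_iff.2 fun b : Letter r => quasiRegular_apply b.toGroup (oneB r),
    ae_all_iff.2 fun b : Letter r =>
      (quasiMeasurePreserving_smul b.toGroup⁻¹).ae_eq_comp hone] with ξ h0 h1 h2 h3 h4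
  simp only [Function.comp_apply] at h4
  rw [h1, h2, Pi.smul_apply, h0, ← sum_halfDensity_letter ξ]
  simp [h3, h4, halfDensity]

/-- The commutant preserves the eigenspace of the sum of the generators that contains `1_𝐁`, and this
eigenspace consists of the constants. -/
theorem commutant_oneB_mem_span (hr : 2 ≤ r) {T : L2Boundary r →L[ℂ] L2Boundary r}
    (hT : T ∈ Set.centralizer (Set.range fun γ : FreeGroup (Fin r) =>
      (quasiRegular r γ : L2Boundary r →L[ℂ] L2Boundary r))) :
    T (oneB r) ∈ Submodule.span ℂ {oneB r} := by
  have heig : ∑ a : Letter r,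
      (quasiRegular r a.toGroup : L2Boundary r →L[ℂ] L2Boundary r) (T (oneB r)) =
      ((2 * √(2 * (r : ℝ) - 1) : ℝ) : ℂ) • T (oneB r) := by
    rw [← map_smul, ← sum_quasiRegular_oneB, map_sum]
    exact Finset.sum_congr rfl fun a _ => DFunLike.congr_fun (hT _ ⟨a.toGroup, rfl⟩) (oneB r)
  have hconst := ae_const_of_invariant hr (integrable_L2Boundary _)
    (invariant_of_eigenvector hr heig)
  refine Submodule.mem_span_singleton.2 ⟨∫ ξ, T (oneB r) ξ ∂boundaryMeasure r, ?_⟩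
  apply Lp.ext
  filter_upwards [hconst, Lp.coeFn_smul (∫ ξ, T (oneB r) ξ ∂boundaryMeasure r) (oneB r),
    Lp.coeFn_const 2 (boundaryMeasure r) (1 : ℂ)] with ξ h1 h2 h3
  rw [h1, h2, Pi.smul_apply, oneB, h3]
  simp

theorem oneB_ne_zero (hr : 2 ≤ r) : oneB r ≠ 0 := by
  have := isProbabilityMeasure_boundaryMeasure (r := r) (by omega)
  rw [← norm_ne_zero_iff, oneB, Lp.norm_const' 2 _ _ two_ne_zero (by simp)]
  simp

end FreeBoundary

/-! ### Irreducibility -/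

theorem mainTheorem3 (r : ℕ) (hr : 2 ≤ r) :
    FreeBoundary.IsIrreducibleUnitary (FreeBoundary.quasiRegular r) ∧
      (Submodule.span ℂ {FreeBoundary.oneB r}).starProjection ∈
        FreeBoundary.vonNeumannAlgebraOf (FreeBoundary.quasiRegular r) ∧
      FreeBoundary.IsCyclicVector (FreeBoundary.quasiRegular r) (FreeBoundary.oneB r) := by
  have hP : (Submodule.span ℂ {FreeBoundary.oneB r}).starProjection ∈
      FreeBoundary.vonNeumannAlgebraOf (FreeBoundary.quasiRegular r) :=
    FreeBoundary.starProjection_span_mem_vonNeumannAlgebraOf fun _ hT =>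
      FreeBoundary.commutant_oneB_mem_span hr hT
  have hc := FreeBoundary.isCyclicVector_oneB hr
  exact ⟨FreeBoundary.isIrreducibleUnitary_of_isCyclicVector (FreeBoundary.oneB_ne_zero hr) hc hP,
    hP, hc⟩
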